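/- For $x,y\in[0,1)$ let $I(x,y)=[x,y)$ if $x\le y$ and $I(x,y)=[0,y)\cup[x,1)$ if $x>y$; for $\boldsymbol{x},\boldsymbol{y}\in[0,1)^d$ let $B(\boldsymbol{x},\boldsymbol{y})=I(x_1,y_1)\times\cdots\times I(x_d,y_d)$. For points $\mathcal P=(\boldsymbol{x}_1,\dots,\boldsymbol{x}_N)$ in $[0,1)^d$ (repetitions allowed) with real weights $\boldsymbol{w}=(w_1,\dots,w_N)$, the periodic $L_2$-discrepancy is $$L_{2,N}^{\rm per}(\mathcal P,\boldsymbol{w})=\left(\int_{[0,1]^d}\int_{[0,1]^d}\Big(\sum_{j:\,\boldsymbol{x}_j\in B(\boldsymbol{x},\boldsymbol{y})}w_j-{\rm volume}(B(\boldsymbol{x},\boldsymbol{y}))\Big)^2\,{\rm d}\boldsymbol{x}\,{\rm d}\boldsymbol{y}\right)^{1/2},$$ and $L_{2,N}^{\rm per}(\mathcal P)$ denotes the case of equal weights $w_j=1/N$. The initial periodic $L_2$-discrepancy is $$L_{2,0}^{\rm per}=\left(\int_{[0,1]^d}\int_{[0,1]^d}{\rm volume}(B(\boldsymbol{x},\boldsymbol{y}))^2\,{\rm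 d}\boldsymbol{x}\,{\rm d}\boldsymbol{y}\right)^{1/2}.$$ For $\varepsilon\in(0,1)$ and $d\in\mathbb N=\{1,2,\dots\}$ let $N_2^{\rm per}(\varepsilon,d)$ be the smallest $N\in\mathbb N$ for which there are $N$ points $\mathcal P$ in $[0,1)^d$ with $L_{2,N}^{\rm per}(\mathcal P)\le\varepsilon\,L_{2,0}^{\rm per}$. Let $N_2^{\rm per,w}(\varepsilon,d)$ and $N_2^{\rm per,w+}(\varepsilon,d)$ be the smallest $N\in\mathbb N$ for which there are $N$ points $\mathcal P$ in $[0,1)^d$ and arbitrary real weights, respectively nonnegative weights, $\boldsymbol{w}$ with $L_{2,N}^{\rm per}(\mathcal P,\boldsymbol{w})\le\varepsilon\,L_{2,0}^{\rm per}$. **Theorem.** For all $\varepsilon\in(0,1)$ and $d\in\mathbb N$, $$N_2^{\rm per}(\varepsilon,d)\ge\frac{1}{1+\varepsilon^2}\left(\frac32\right)^d\quad\text{and}\quad N_2^{\rm per,w+}(\varepsilon,d)\ge(1-\varepsilon^2)\left(\frac32\right)^d.$$ Moreover, for every $\varepsilon_0\in(0,1)$ there exists $c>0$ such that $$N_2^{\rm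 per,w}(\varepsilon,d)\ge c\cdot 1.0628^d\qquad\text{for all } d\in\mathbb N \text{ and } \varepsilon\in(0,\varepsilon_0).$$ (That is, the inverse of the periodic $L_2$-discrepancy suffers from the curse of dimensionality.) -/

import Mathlib

open MeasureTheory

namespace PeriodicDiscrepancy

noncomputable section

/-- The periodic interval `I(x, y) ⊆ [0, 1)`. -/
def periodicInterval (x y : ℝ) : Set ℝ :=
  if x ≤ y then Set.Ico x y else Set.Ico 0 y ∪ Set.Ico x 1

/-- The periodic box `B(x, y) = I(x₁, y₁) × ⋯ × I(x_d, y_d)`. -/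
def periodicBox {d : ℕ} (x y : Fin d → ℝ) : Set (Fin d → ℝ) :=
  Set.univ.pi fun i => periodicInterval (x i) (y i)

open Classical in
/-- The local discrepancy of the points `P j` with weights `w j` with respect to the set `B`:
the sum of the weights of the points in `B`, minus the Lebesgue measure of `B`. -/
def localDiscrepancy {d N : ℕ} (P : Fin N → Fin d → ℝ) (w : Fin N → ℝ)
    (B : Set (Fin d → ℝ)) : ℝ :=
  (∑ j with P j ∈ B, w j) - (volume B).toReal

/-- The periodic `L₂`-discrepancy of a weighted point set.
`Set.Icc 0 1` is the cube `[0, 1]^d` (coordinatewise order). -/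
def weightedPerL2Discrepancy {d N : ℕ} (P : Fin N → Fin d → ℝ) (w : Fin N → ℝ) : ℝ :=
  Real.sqrt (∫ y in Set.Icc (0 : Fin d → ℝ) 1, ∫ x in Set.Icc (0 : Fin d → ℝ) 1,
    localDiscrepancy P w (periodicBox x y) ^ 2)

/-- The periodic `L₂`-discrepancy of a point set: all weights are `1 / N`. -/
def perL2Discrepancy {d N : ℕ} (P : Fin N → Fin d → ℝ) : ℝ :=
  weightedPerL2Discrepancy P fun _ => 1 / (N : ℝ)

/-- The initial periodic `L₂`-discrepancy in dimension `d`. -/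
def initialPerL2Discrepancy (d : ℕ) : ℝ :=
  Real.sqrt (∫ y in Set.Icc (0 : Fin d → ℝ) 1, ∫ x in Set.Icc (0 : Fin d → ℝ) 1,
    (volume (periodicBox x y)).toReal ^ 2)

/-- All points lie in `[0, 1)^d`. Repeated points are allowed. -/
def InUnitCube {d N : ℕ} (P : Fin N → Fin d → ℝ) : Prop :=
  ∀ j i, P j i ∈ Set.Ico (0 : ℝ) 1

/-- The inverse of the periodic `L₂`-discrepancy. The infimum of an empty set of natural numbers
is `0`, so a positive lower bound also says that the minimum exists. -/
def inversePer (ε : ℝ) (d : ℕ) : ℕ :=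
  sInf {N : ℕ | 0 < N ∧ ∃ P : Fin N → Fin d → ℝ, InUnitCube P ∧
    perL2Discrepancy P ≤ ε * initialPerL2Discrepancy d}

/-- The inverse of the weighted periodic `L₂`-discrepancy, for nonnegative weights. -/
def inversePerNonnegWeights (ε : ℝ) (d : ℕ) : ℕ :=
  sInf {N : ℕ | 0 < N ∧ ∃ (P : Fin N → Fin d → ℝ) (w : Fin N → ℝ), InUnitCube P ∧
    (∀ j, 0 ≤ w j) ∧ weightedPerL2Discrepancy P w ≤ ε * initialPerL2Discrepancy d}

/-- The inverse of the weighted periodic `L₂`-discrepancy, for arbitrary real weights. -/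
def inversePerWeights (ε : ℝ) (d : ℕ) : ℕ :=
  sInf {N : ℕ | 0 < N ∧ ∃ (P : Fin N → Fin d → ℝ) (w : Fin N → ℝ), InUnitCube P ∧
    weightedPerL2Discrepancy P w ≤ ε * initialPerL2Discrepancy d}

end

end PeriodicDiscrepancy

/-! Expanding the square, every term factors over the coordinates. After division by the squared
initial discrepancy `(1/3)^d`, the error is `Q(w) - 2 ∑ w + 1`, where `Q` is the quadratic form of
the product kernel built from `perKernel` (`integral_localDiscrepancy_sq`).

The kernel is nonnegative with diagonal `3/2`. For nonnegative weights `Q` is therefore at least its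
diagonal part `(3/2)^d ∑ w²`, which gives the first two bounds.

Signed weights allow cancellation off the diagonal. By its Fourier series, `perKernel` dominates, in
the positive semidefinite order, the square of `trigKernel` (`posSemidef_perKernel_sub_sq`). This
passes to products over coordinates, and Vybíral's inequality (`sq_sum_diag_le_card_mul_sum_sq`)
yields `N Q ≥ C (∑ w)²` with `C = (1.115²)^d`. Minimizing over `∑ w` gives `N ≥ (1 - ε²) C`.

Regular grids show that the minima defining the inverses exist. -/

namespace PeriodicDiscrepancy

noncomputable section

/-! ### One-dimensional indicator and length functions -/

open Classical in
/-- The indicator function of `t ∈ I(x, y)`. -/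
def arcIndicator (t x y : ℝ) : ℝ := if t ∈ periodicInterval x y then 1 else 0

/-- The length of `I(x, y)` for `x, y ∈ [0, 1]`. -/
def arcLength (x y : ℝ) : ℝ := if x ≤ y then y - x else 1 + y - x

/-- The Lebesgue measure on `[0, 1]`. -/
abbrev unitMeasure : Measure ℝ := volume.restrict (Set.Icc 0 1)

lemma mem_periodicInterval {t x y : ℝ} (ht : t ∈ Set.Ico (0 : ℝ) 1) :
    t ∈ periodicInterval x y ↔ if x ≤ y then x ≤ t ∧ t < y else t < y ∨ x ≤ t := by
  unfold periodicInterval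
  split_ifs <;> simp [ht.1, ht.2]

lemma volume_periodicInterval {x y : ℝ} (hx : x ∈ Set.Icc (0 : ℝ) 1)
    (hy : y ∈ Set.Icc (0 : ℝ) 1) :
    (volume (periodicInterval x y)).toReal = arcLength x y := by
  unfold periodicInterval arcLength
  split_ifs with h
  · rw [Real.volume_Ico, ENNReal.toReal_ofReal (by linarith)]
  · rw [measure_union _ measurableSet_Ico, Real.volume_Ico, Real.volume_Ico,
      ENNReal.toReal_add (by simp) (by simp), ENNReal.toReal_ofReal (by linarith [hy.1]),
      ENNReal.toReal_ofReal (by linarith [hx.2])]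
    · ring
    · rw [Set.disjoint_left]
      intro z hz hz'
      linarith [hz.2, hz'.1]

lemma measurable_arcIndicator {t : ℝ} (ht : t ∈ Set.Ico (0 : ℝ) 1) :
    Measurable (Function.uncurry (arcIndicator t)) := by
  have : Function.uncurry (arcIndicator t) = fun p : ℝ × ℝ =>
      if p.1 ≤ p.2 then (if p.1 ≤ t then (if t < p.2 then (1 : ℝ) else 0) else 0)
      else (if t < p.2 then 1 else if p.1 ≤ t then 1 else 0) := by
    funext ⟨x, y⟩
    simp only [Function.uncurry, arcIndicator, mem_periodicInterval ht]
    split_ifs <;> grind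
  rw [this]
  refine Measurable.ite (measurableSet_le measurable_fst measurable_snd) ?_ ?_
  · exact Measurable.ite (measurableSet_le measurable_fst measurable_const)
      (Measurable.ite (measurableSet_lt measurable_const measurable_snd)
        measurable_const measurable_const) measurable_const
  · exact Measurable.ite (measurableSet_lt measurable_const measurable_snd) measurable_const
      (Measurable.ite (measurableSet_le measurable_fst measurable_const)
        measurable_const measurable_const)

lemma measurable_arcLength : Measurable (Function.uncurry arcLength) :=
  Measurable.ite (measurableSet_le measurable_fst measurable_snd)
    (measurable_snd.sub measurable_fst) ((measurable_snd.const_add 1).sub measurable_fst)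

/-- A measurable function of two variables that is bounded by one on the unit square. -/
def UnitBounded (f : ℝ → ℝ → ℝ) : Prop :=
  Measurable (Function.uncurry f) ∧
    ∀ x ∈ Set.Icc (0 : ℝ) 1, ∀ y ∈ Set.Icc (0 : ℝ) 1, |f x y| ≤ 1

lemma unitBounded_arcIndicator {t : ℝ} (ht : t ∈ Set.Ico (0 : ℝ) 1) :
    UnitBounded (arcIndicator t) := by
  refine ⟨measurable_arcIndicator ht, fun x _ y _ => ?_⟩
  unfold arcIndicator
  split_ifs <;> simp

lemma unitBounded_arcLength : UnitBounded arcLength := by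
  refine ⟨measurable_arcLength, fun x hx y hy => ?_⟩
  unfold arcLength
  obtain ⟨h1, h2⟩ := hx
  obtain ⟨h3, h4⟩ := hy
  split_ifs <;> rw [abs_le] <;> constructor <;> linarith

lemma UnitBounded.mul {f g : ℝ → ℝ → ℝ} (hf : UnitBounded f) (hg : UnitBounded g) :
    UnitBounded fun x y => f x y * g x y := by
  refine ⟨hf.1.mul hg.1, fun x hx y hy => ?_⟩
  rw [abs_mul]
  exact mul_le_one₀ (hf.2 x hx y hy) (abs_nonneg _) (hg.2 x hx y hy)

lemma UnitBounded.integrable_left {f : ℝ → ℝ → ℝ} (hf : UnitBounded f) {y : ℝ}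
    (hy : y ∈ Set.Icc (0 : ℝ) 1) : Integrable (fun x => f x y) unitMeasure := by
  refine Integrable.of_bound (C := 1) ?_ ?_
  · exact (hf.1.comp (measurable_id.prodMk measurable_const)).aestronglyMeasurable
  · filter_upwards [ae_restrict_mem measurableSet_Icc] with x hx using hf.2 x hx y hy

lemma UnitBounded.integrable_integral {f : ℝ → ℝ → ℝ} (hf : UnitBounded f) :
    Integrable (fun y => ∫ x, f x y ∂unitMeasure) unitMeasure := by
  have h : Integrable (Function.uncurry f) (unitMeasure.prod unitMeasure) := by
    refine Integrable.of_bound (C := 1) hf.1.aestronglyMeasurable ?_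
    rw [Measure.prod_restrict]
    filter_upwards [ae_restrict_mem (measurableSet_Icc.prod measurableSet_Icc)] with p hp
      using hf.2 _ hp.1 _ hp.2
  exact h.integral_prod_right

/-! ### Factorization of integrals over the cube -/

variable {d : ℕ}

lemma restrict_cube_eq_pi :
    (volume : Measure (Fin d → ℝ)).restrict (Set.Icc 0 1) = Measure.pi fun _ => unitMeasure := by
  rw [← Measure.restrict_pi_pi, ← Set.pi_univ_Icc]
  rfl

lemma integral_prod_integral (f : Fin d → ℝ → ℝ → ℝ) :
    ∫ y in Set.Icc (0 : Fin d → ℝ) 1, ∫ x in Set.Icc (0 : Fin d → ℝ) 1, ∏ i, f i (x i) (y i) =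
      ∏ i, ∫ y, ∫ x, f i x y ∂unitMeasure ∂unitMeasure := by
  rw [restrict_cube_eq_pi]
  have (y : Fin d → ℝ) : ∫ x, ∏ i, f i (x i) (y i) ∂(Measure.pi fun _ => unitMeasure) =
      ∏ i, ∫ x, f i x (y i) ∂unitMeasure :=
    integral_fintype_prod_eq_prod (fun i x => f i x (y i))
  simp_rw [this]
  exact integral_fintype_prod_eq_prod (fun i y => ∫ x, f i x y ∂unitMeasure)

/-- Boundedness enters only as integrability, to exchange the finite sum with both integrals. -/
lemma integral_sum_prod_integral {ι : Type*} [Fintype ι] (c : ι → ℝ)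
    (f : ι → Fin d → ℝ → ℝ → ℝ) (hf : ∀ a i, UnitBounded (f a i)) :
    ∫ y in Set.Icc (0 : Fin d → ℝ) 1, ∫ x in Set.Icc (0 : Fin d → ℝ) 1,
      ∑ a, c a * ∏ i, f a i (x i) (y i) =
      ∑ a, c a * ∏ i, ∫ y, ∫ x, f a i x y ∂unitMeasure ∂unitMeasure := by
  have inner : ∀ y ∈ Set.Icc (0 : Fin d → ℝ) 1, ∫ x in Set.Icc (0 : Fin d → ℝ) 1,
      ∑ a, c a * ∏ i, f a i (x i) (y i) =
      ∑ a, c a * ∫ x in Set.Icc (0 : Fin d → ℝ) 1, ∏ i, f a i (x i) (y i) := by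
    intro y hy
    rw [integral_finsetSum]
    · simp_rw [integral_const_mul]
    · intro a _
      refine Integrable.const_mul ?_ _
      rw [restrict_cube_eq_pi]
      exact Integrable.fintype_prod (f := fun i x => f a i x (y i))
        fun i => (hf a i).integrable_left ⟨hy.1 i, hy.2 i⟩
  rw [setIntegral_congr_fun measurableSet_Icc inner, integral_finsetSum]
  · simp_rw [integral_const_mul, integral_prod_integral]
  · intro a _
    refine Integrable.const_mul ?_ _
    rw [restrict_cube_eq_pi]
    have (y : Fin d → ℝ) : ∫ x, ∏ i, f a i (x i) (y i) ∂(Measure.pi fun _ => unitMeasure) =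
        ∏ i, ∫ x, f a i x (y i) ∂unitMeasure :=
      integral_fintype_prod_eq_prod (fun i x => f a i x (y i))
    simp_rw [this]
    exact Integrable.fintype_prod (f := fun i y => ∫ x, f a i x y ∂unitMeasure)
      fun i => (hf a i).integrable_integral

/-! ### The one-dimensional integrals -/

lemma intervalIntegral_of_eq_quadratic {f : ℝ → ℝ} {u v : ℝ} (huv : u ≤ v) (a b c : ℝ)
    (h : ∀ x ∈ Set.Ioo u v, f x = a + b * x + c * x ^ 2) :
    IntervalIntegrable f volume u v ∧
      ∫ x in u..v, f x = a * (v - u) + b * (v ^ 2 - u ^ 2) / 2 + c * (v ^ 3 - u ^ 3) / 3 := by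
  have hc : Continuous fun x : ℝ => a + b * x + c * x ^ 2 := by fun_prop
  constructor
  · refine (hc.intervalIntegrable u v).congr_uIoo ?_
    rw [Set.uIoo_of_le huv]
    exact fun x hx => (h x hx).symm
  · rw [intervalIntegral.integral_congr_Ioo_of_le huv h,
      intervalIntegral.integral_eq_sub_of_hasDerivAt
        (f := fun x => a * x + b * x ^ 2 / 2 + c * x ^ 3 / 3) _ (hc.intervalIntegrable u v)]
    · ring
    · intro x _
      have h1 := ((hasDerivAt_id x).const_mul a).add
        ((((hasDerivAt_id x).pow 2).const_mul b).div_const 2)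
      have h2 := h1.add ((((hasDerivAt_id x).pow 3).const_mul c).div_const 3)
      refine h2.congr_deriv ?_
      simp only [id_eq]
      norm_num
      ring

/-- The integral over `[0, 1]` of a function that is quadratic on three consecutive intervals. -/
lemma integral_unitMeasure_of_eq_quadratic {f : ℝ → ℝ} {u v : ℝ} (hu : 0 ≤ u) (huv : u ≤ v)
    (hv : v ≤ 1) (a₁ b₁ c₁ a₂ b₂ c₂ a₃ b₃ c₃ : ℝ)
    (h₁ : ∀ x ∈ Set.Ioo 0 u, f x = a₁ + b₁ * x + c₁ * x ^ 2)
    (h₂ : ∀ x ∈ Set.Ioo u v, f x = a₂ + b₂ * x + c₂ * x ^ 2)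
    (h₃ : ∀ x ∈ Set.Ioo v 1, f x = a₃ + b₃ * x + c₃ * x ^ 2) :
    ∫ x, f x ∂unitMeasure =
      (a₁ * u + b₁ * u ^ 2 / 2 + c₁ * u ^ 3 / 3) +
      (a₂ * (v - u) + b₂ * (v ^ 2 - u ^ 2) / 2 + c₂ * (v ^ 3 - u ^ 3) / 3) +
      (a₃ * (1 - v) + b₃ * (1 - v ^ 2) / 2 + c₃ * (1 - v ^ 3) / 3) := by
  obtain ⟨i₁, e₁⟩ := intervalIntegral_of_eq_quadratic hu _ _ _ h₁
  obtain ⟨i₂, e₂⟩ := intervalIntegral_of_eq_quadratic huv _ _ _ h₂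
  obtain ⟨i₃, e₃⟩ := intervalIntegral_of_eq_quadratic hv _ _ _ h₃
  rw [integral_Icc_eq_integral_Ioc, ← intervalIntegral.integral_of_le zero_le_one,
    ← intervalIntegral.integral_add_adjacent_intervals (i₁.trans i₂) i₃,
    ← intervalIntegral.integral_add_adjacent_intervals i₁ i₂, e₁, e₂, e₃]
  ring

/-- For fixed `y` the length is uniformly distributed on `[0, 1]` as `x` varies, so the inner
integral is already `∫ u² du`. -/
lemma integral_arcLength_sq :
    ∫ y, ∫ x, arcLength x y * arcLength x y ∂unitMeasure ∂unitMeasure = 1 / 3 := by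
  have inner : ∀ y ∈ Set.Icc (0 : ℝ) 1,
      ∫ x, arcLength x y * arcLength x y ∂unitMeasure = 1 / 3 := by
    intro y hy
    -- There are only two regimes, so both breakpoints are `y` and the middle interval is empty.
    rw [integral_unitMeasure_of_eq_quadratic hy.1 le_rfl hy.2 (y ^ 2) (-2 * y) 1 0 0 0
      ((1 + y) ^ 2) (-2 * (1 + y)) 1]
    · ring
    · intro x hx
      rw [arcLength, if_pos hx.2.le]; ring
    · intro x hx
      exact absurd (hx.1.trans hx.2) (lt_irrefl _)
    · intro x hx
      rw [arcLength, if_neg (not_le.2 hx.1)]; ring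
  rw [setIntegral_congr_fun measurableSet_Icc inner]
  simp

/-- By rotation invariance of the circle the value cannot depend on `t`; hence the linear term of
the error sees only `∑ w`. -/
lemma integral_arcIndicator_mul_arcLength {t : ℝ} (ht : t ∈ Set.Ico (0 : ℝ) 1) :
    ∫ y, ∫ x, arcIndicator t x y * arcLength x y ∂unitMeasure ∂unitMeasure = 1 / 3 := by
  have inner₁ : ∀ y, 0 ≤ y → y ≤ t →
      ∫ x, arcIndicator t x y * arcLength x y ∂unitMeasure = (1 - (1 + y - t) ^ 2) / 2 := by
    intro y hy hyt
    rw [integral_unitMeasure_of_eq_quadratic hy hyt ht.2.le 0 0 0 (1 + y) (-1) 0 0 0 0]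
    · ring
    all_goals
      intro x ⟨h1, h2⟩
      rw [arcIndicator, arcLength]
      simp only [mem_periodicInterval ht]
      grind
  have inner₂ : ∀ y, t < y → y ≤ 1 →
      ∫ x, arcIndicator t x y * arcLength x y ∂unitMeasure = (1 - (y - t) ^ 2) / 2 := by
    intro y hty hy
    rw [integral_unitMeasure_of_eq_quadratic ht.1 hty.le hy y (-1) 0 0 0 0 (1 + y) (-1) 0]
    · ring
    all_goals
      intro x ⟨h1, h2⟩
      rw [arcIndicator, arcLength]
      simp only [mem_periodicInterval ht]
      grind
  rw [integral_unitMeasure_of_eq_quadratic ht.1 le_rfl ht.2.le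
    ((1 - (1 - t) ^ 2) / 2) (-(1 - t)) (-1 / 2) 0 0 0 ((1 - t ^ 2) / 2) t (-1 / 2)]
  · ring
  · intro y hy
    rw [inner₁ y hy.1.le hy.2.le]; ring
  · intro y hy
    exact absurd (hy.1.trans hy.2) (lt_irrefl _)
  · intro y hy
    rw [inner₂ y hy.1 hy.2.le]; ring

/-- With `δ = t - s`, the value is `((1 - δ)² + δ²) / 2`: both random endpoints must fall in the
same one of the two arcs cut out by `s` and `t`, and then one of their two orders is right. -/
lemma integral_arcIndicator_mul_arcIndicator_of_le {s t : ℝ} (hs : s ∈ Set.Ico (0 : ℝ) 1)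
    (ht : t ∈ Set.Ico (0 : ℝ) 1) (hst : s ≤ t) :
    ∫ y, ∫ x, arcIndicator s x y * arcIndicator t x y ∂unitMeasure ∂unitMeasure =
      1 / 2 - (t - s) + (t - s) ^ 2 := by
  have inner₁ : ∀ y, 0 ≤ y → y ≤ s →
      ∫ x, arcIndicator s x y * arcIndicator t x y ∂unitMeasure = s - y := by
    intro y hy hys
    rw [integral_unitMeasure_of_eq_quadratic hy hys hs.2.le 0 0 0 1 0 0 0 0 0]
    · ring
    all_goals
      intro x ⟨h1, h2⟩
      rw [arcIndicator, arcIndicator]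
      simp only [mem_periodicInterval ht, mem_periodicInterval hs]
      grind
  have inner₂ : ∀ y, s < y → y ≤ t →
      ∫ x, arcIndicator s x y * arcIndicator t x y ∂unitMeasure = t - y := by
    intro y hsy hyt
    rw [integral_unitMeasure_of_eq_quadratic (hs.1.trans hsy.le) hyt ht.2.le 0 0 0 1 0 0 0 0 0]
    · ring
    all_goals
      intro x ⟨h1, h2⟩
      rw [arcIndicator, arcIndicator]
      simp only [mem_periodicInterval ht, mem_periodicInterval hs]
      grind
  have inner₃ : ∀ y, t < y → y ≤ 1 →
      ∫ x, arcIndicator s x y * arcIndicator t x y ∂unitMeasure = s + 1 - y := by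
    intro y hty hy
    rw [integral_unitMeasure_of_eq_quadratic hs.1 (hst.trans hty.le) hy 1 0 0 0 0 0 1 0 0]
    · ring
    all_goals
      intro x ⟨h1, h2⟩
      rw [arcIndicator, arcIndicator]
      simp only [mem_periodicInterval ht, mem_periodicInterval hs]
      grind
  rw [integral_unitMeasure_of_eq_quadratic hs.1 hst ht.2.le s (-1) 0 t (-1) 0 (s + 1) (-1) 0]
  · ring
  · intro y hy
    rw [inner₁ y hy.1.le hy.2.le]; ring
  · intro y hy
    rw [inner₂ y hy.1 hy.2.le]; ring
  · intro y hy
    rw [inner₃ y hy.1 hy.2.le]; ring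

lemma integral_arcIndicator_mul_arcIndicator {s t : ℝ} (hs : s ∈ Set.Ico (0 : ℝ) 1)
    (ht : t ∈ Set.Ico (0 : ℝ) 1) :
    ∫ y, ∫ x, arcIndicator s x y * arcIndicator t x y ∂unitMeasure ∂unitMeasure =
      1 / 2 - |s - t| + |s - t| ^ 2 := by
  rcases le_total s t with h | h
  · rw [integral_arcIndicator_mul_arcIndicator_of_le hs ht h, abs_of_nonpos (by linarith)]
    ring
  · simp_rw [mul_comm (arcIndicator s _ _)]
    rw [integral_arcIndicator_mul_arcIndicator_of_le ht hs h, abs_of_nonneg (by linarith)]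

/-! ### The discrepancy as a quadratic function of the weights -/

/-- The one-dimensional kernel, normalized to have mean one. -/
def perKernel (s t : ℝ) : ℝ := 3 / 2 - 3 * |s - t| + 3 * |s - t| ^ 2

open Classical in
lemma localDiscrepancy_periodicBox {N : ℕ} (P : Fin N → Fin d → ℝ) (w : Fin N → ℝ)
    {x y : Fin d → ℝ} (hx : x ∈ Set.Icc (0 : Fin d → ℝ) 1) (hy : y ∈ Set.Icc (0 : Fin d → ℝ) 1) :
    localDiscrepancy P w (periodicBox x y) =
      (∑ j, w j * ∏ i, arcIndicator (P j i) (x i) (y i)) - ∏ i, arcLength (x i) (y i) := by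
  unfold localDiscrepancy periodicBox
  congr 1
  · rw [Finset.sum_filter]
    refine Finset.sum_congr rfl fun j _ => ?_
    simp only [arcIndicator, Finset.prod_ite_zero, Finset.prod_const_one, Set.mem_univ_pi,
      Finset.mem_univ, true_implies]
    split_ifs <;> simp
  · rw [volume_pi_pi, ENNReal.toReal_prod]
    exact Finset.prod_congr rfl fun i _ =>
      volume_periodicInterval ⟨hx.1 i, hx.2 i⟩ ⟨hy.1 i, hy.2 i⟩

/-- The square of the normalized discrepancy as a quadratic function of the weights. -/
def normalizedError {N : ℕ} (P : Fin N → Fin d → ℝ) (w : Fin N → ℝ) : ℝ :=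
  (∑ j, ∑ k, w j * w k * ∏ i, perKernel (P j i) (P k i)) - 2 * ∑ j, w j + 1

/-- Warnock-type formula for the periodic discrepancy. -/
lemma integral_localDiscrepancy_sq {N : ℕ} {P : Fin N → Fin d → ℝ} (hP : InUnitCube P)
    (w : Fin N → ℝ) :
    ∫ y in Set.Icc (0 : Fin d → ℝ) 1, ∫ x in Set.Icc (0 : Fin d → ℝ) 1,
      localDiscrepancy P w (periodicBox x y) ^ 2 = (1 / 3) ^ d * normalizedError P w := by
  -- The index `none` carries the volume with coefficient `-1`, making the local discrepancy a
  -- single sum of products.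
  let c : Option (Fin N) → ℝ := fun o => o.elim (-1) w
  let f : Option (Fin N) → Fin d → ℝ → ℝ → ℝ :=
    fun o i => o.elim arcLength fun j => arcIndicator (P j i)
  have hf : ∀ o i, UnitBounded (f o i) := by
    rintro (_ | j) i
    · exact unitBounded_arcLength
    · exact unitBounded_arcIndicator (hP j i)
  have key := integral_sum_prod_integral (d := d) (ι := Option (Fin N) × Option (Fin N))
    (fun p => c p.1 * c p.2) (fun p i x y => f p.1 i x y * f p.2 i x y)
    (fun p i => (hf p.1 i).mul (hf p.2 i))
  have e : ∀ y ∈ Set.Icc (0 : Fin d → ℝ) 1, ∫ x in Set.Icc (0 : Fin d → ℝ) 1,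
      localDiscrepancy P w (periodicBox x y) ^ 2 = ∫ x in Set.Icc (0 : Fin d → ℝ) 1,
        ∑ p : Option (Fin N) × Option (Fin N), c p.1 * c p.2 *
          ∏ i, (f p.1 i (x i) (y i) * f p.2 i (x i) (y i)) := by
    intro y hy
    refine setIntegral_congr_fun measurableSet_Icc fun x hx => ?_
    have hD : localDiscrepancy P w (periodicBox x y) =
        ∑ o, c o * ∏ i, f o i (x i) (y i) := by
      rw [localDiscrepancy_periodicBox P w hx hy, Fintype.sum_option]
      simp only [c, f, Option.elim]
      ring
    simp only [hD]
    rw [sq, Finset.sum_mul_sum, ← Finset.sum_product']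
    refine Finset.sum_congr rfl fun p _ => ?_
    rw [Finset.prod_mul_distrib]
    ring
  rw [setIntegral_congr_fun measurableSet_Icc e, key, Fintype.sum_prod_type,
    Fintype.sum_option]
  simp only [Fintype.sum_option, c, f, Option.elim]
  have h1 : ∀ j i, ∫ y, ∫ x, arcLength x y * arcIndicator (P j i) x y ∂unitMeasure ∂unitMeasure
      = 1 / 3 := by
    intro j i
    simp_rw [mul_comm (arcLength _ _)]
    exact integral_arcIndicator_mul_arcLength (hP j i)
  have h2 : ∀ j i, ∫ y, ∫ x, arcIndicator (P j i) x y * arcLength x y ∂unitMeasure ∂unitMeasure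
      = 1 / 3 := fun j i => integral_arcIndicator_mul_arcLength (hP j i)
  have h3 : ∀ j k i, ∫ y, ∫ x, arcIndicator (P j i) x y * arcIndicator (P k i) x y
      ∂unitMeasure ∂unitMeasure = 1 / 3 * perKernel (P j i) (P k i) := by
    intro j k i
    rw [integral_arcIndicator_mul_arcIndicator (hP j i) (hP k i), perKernel]
    ring
  simp only [h1, h2, h3, integral_arcLength_sq, Finset.prod_mul_distrib, Finset.prod_const,
    Finset.card_univ, Fintype.card_fin, normalizedError, Finset.sum_add_distrib]
  simp only [mul_left_comm _ ((1 / 3 : ℝ) ^ d), mul_comm _ ((1 / 3 : ℝ) ^ d),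
    ← Finset.mul_sum, neg_one_mul, Finset.sum_neg_distrib, mul_neg]
  ring_nf

lemma initialPerL2Discrepancy_eq (d : ℕ) :
    initialPerL2Discrepancy d = Real.sqrt ((1 / 3) ^ d) := by
  -- Without points the local discrepancy is minus the volume.
  have h := integral_localDiscrepancy_sq (d := d) (N := 0) (P := fun j => j.elim0)
    (fun j => j.elim0) (fun j => j.elim0)
  simp only [localDiscrepancy, normalizedError, Finset.univ_eq_empty, Finset.filter_empty,
    Finset.sum_empty, zero_sub, neg_sq, mul_zero, sub_zero, zero_add, mul_one] at h
  rw [initialPerL2Discrepancy, h]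

lemma weightedPerL2Discrepancy_le_iff {N : ℕ} {P : Fin N → Fin d → ℝ} (hP : InUnitCube P)
    (w : Fin N → ℝ) {ε : ℝ} (hε : 0 < ε) :
    weightedPerL2Discrepancy P w ≤ ε * initialPerL2Discrepancy d ↔
      normalizedError P w ≤ ε ^ 2 := by
  have h3 : (0 : ℝ) < (1 / 3) ^ d := by positivity
  rw [weightedPerL2Discrepancy, integral_localDiscrepancy_sq hP, initialPerL2Discrepancy_eq,
    Real.sqrt_le_left (by positivity), mul_pow, Real.sq_sqrt h3.le, mul_comm (ε ^ 2)]
  exact mul_le_mul_iff_right₀ h3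

/-! ### Positive semidefinite matrices and entrywise products -/

open scoped MatrixOrder

variable {N : ℕ}

lemma posSemidef_of_sum_nonneg {ι : Type*} [Fintype ι] {A : Matrix ι ι ℝ}
    (hA : ∀ i j, A i j = A j i) (h : ∀ w : ι → ℝ, 0 ≤ ∑ i, ∑ j, w i * w j * A i j) :
    A.PosSemidef := by
  refine Matrix.PosSemidef.of_dotProduct_mulVec_nonneg
    (Matrix.IsHermitian.ext fun i j => by simp [hA i j]) fun w => ?_
  refine (h w).trans_eq ?_
  simp only [dotProduct, Matrix.mulVec, Finset.mul_sum, star_trivial]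
  exact Finset.sum_congr rfl fun i _ => Finset.sum_congr rfl fun j _ => by ring

lemma sum_nonneg_of_posSemidef {ι : Type*} [Fintype ι] {A : Matrix ι ι ℝ}
    (hA : A.PosSemidef) (w : ι → ℝ) : 0 ≤ ∑ i, ∑ j, w i * w j * A i j := by
  refine (hA.dotProduct_mulVec_nonneg w).trans_eq ?_
  simp only [dotProduct, Matrix.mulVec, Finset.mul_sum, star_trivial]
  exact Finset.sum_congr rfl fun i _ => Finset.sum_congr rfl fun j _ => by ring

/-- Vybíral's lower bound for the Schur square of a positive semidefinite matrix. -/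
lemma sq_sum_diag_le_card_mul_sum_sq {ι : Type*} [Fintype ι] {A : Matrix ι ι ℝ}
    (hA : A.PosSemidef) (w : ι → ℝ) :
    (∑ i, w i * A i i) ^ 2 ≤ Fintype.card ι * ∑ i, ∑ j, w i * w j * A i j ^ 2 := by
  classical
  obtain ⟨B, hB⟩ : ∃ B : Matrix ι ι ℝ, ∀ i j, A i j = ∑ k, B k i * B k j := by
    obtain ⟨B, rfl⟩ := CStarAlgebra.nonneg_iff_eq_star_mul_self.mp hA.nonneg
    exact ⟨B, fun i j => by simp [Matrix.mul_apply, Matrix.star_apply]⟩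
  -- `T = B diag(w) Bᵀ` has trace `∑ wᵢ Aᵢᵢ`, and its squared Frobenius norm is the form of the
  -- Schur square. Cauchy–Schwarz on the diagonal of `T` then suffices.
  let T : ι → ι → ℝ := fun k l => ∑ i, w i * (B k i * B l i)
  have trace_eq : ∑ i, w i * A i i = ∑ k, T k k := by
    simp only [T, hB, Finset.mul_sum]
    exact Finset.sum_comm
  have frob_eq : ∑ i, ∑ j, w i * w j * A i j ^ 2 = ∑ k, ∑ l, T k l ^ 2 := by
    have h1 : ∀ k l, T k l ^ 2 = ∑ i, ∑ j, w i * w j * ((B k i * B k j) * (B l i * B l j)) := by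
      intro k l
      rw [sq, Finset.sum_mul_sum]
      exact Finset.sum_congr rfl fun i _ => Finset.sum_congr rfl fun j _ => by ring
    have h2 : ∀ i j, w i * w j * A i j ^ 2 =
        ∑ k, ∑ l, w i * w j * ((B k i * B k j) * (B l i * B l j)) := by
      intro i j
      rw [hB, sq, Finset.sum_mul_sum]
      simp only [Finset.mul_sum]
    simp only [h1, h2]
    calc _ = ∑ i, ∑ k, ∑ j, ∑ l, _ := Finset.sum_congr rfl fun i _ => Finset.sum_comm
      _ = ∑ k, ∑ i, ∑ j, ∑ l, _ := Finset.sum_comm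
      _ = ∑ k, ∑ i, ∑ l, ∑ j, _ := Finset.sum_congr rfl fun k _ =>
        Finset.sum_congr rfl fun i _ => Finset.sum_comm
      _ = _ := Finset.sum_congr rfl fun k _ => Finset.sum_comm
  rw [trace_eq, frob_eq]
  refine (sq_sum_le_card_mul_sum_sq (s := Finset.univ) (f := fun k => T k k)).trans ?_
  rw [Finset.card_univ]
  gcongr with k
  exact Finset.single_le_sum (f := fun l => T k l ^ 2) (fun l _ => sq_nonneg _) (Finset.mem_univ k)

lemma posSemidef_prod {ι κ : Type*} [Fintype ι] (s : Finset κ) (A : κ → Matrix ι ι ℝ)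
    (hA : ∀ l, (A l).PosSemidef) : (Matrix.of fun i j => ∏ l ∈ s, A l i j).PosSemidef := by
  classical
  induction s using Finset.induction_on with
  | empty =>
    refine posSemidef_of_sum_nonneg (fun i j => by simp) fun w => ?_
    simp only [Finset.prod_empty, Matrix.of_apply, mul_one, ← Finset.sum_mul_sum]
    exact mul_self_nonneg _
  | insert a s ha ih =>
    convert! (hA a).hadamard ih using 1
    ext i j
    simp [Finset.prod_insert ha, Matrix.hadamard_apply]

/-- Entrywise products are monotone with respect to the Loewner order. -/
lemma posSemidef_prod_sub_prod {ι κ : Type*} [Fintype ι] (s : Finset κ) (A B : κ → Matrix ι ι ℝ)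
    (hB : ∀ l, (B l).PosSemidef) (hAB : ∀ l, (A l - B l).PosSemidef) :
    (Matrix.of fun i j => ∏ l ∈ s, A l i j - ∏ l ∈ s, B l i j).PosSemidef := by
  classical
  have hA : ∀ l, (A l).PosSemidef := fun l => by
    simpa using (hAB l).add (hB l)
  induction s using Finset.induction_on with
  | empty =>
    convert! Matrix.PosSemidef.zero (n := ι) (R := ℝ) using 1
    ext i j
    simp
  | insert a s ha ih =>
    -- Telescoping, with entrywise products: `A A' - B B' = A (A' - B') + (A - B) B'`.
    convert! ((hA a).hadamard ih).add ((hAB a).hadamard (posSemidef_prod s B hB)) using 1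
    ext i j
    simp only [Finset.prod_insert ha, Matrix.hadamard_apply, Matrix.of_apply, Matrix.add_apply,
      Matrix.sub_apply]
    ring

/-- The sum is `|∑ wⱼ exp(i θⱼ)|²`. -/
lemma sum_cos_sub_nonneg {ι : Type*} [Fintype ι] (w θ : ι → ℝ) :
    0 ≤ ∑ i, ∑ j, w i * w j * Real.cos (θ i - θ j) := by
  have : ∑ i, ∑ j, w i * w j * Real.cos (θ i - θ j) =
      (∑ i, w i * Real.cos (θ i)) ^ 2 + (∑ i, w i * Real.sin (θ i)) ^ 2 := by
    rw [sq, sq, Finset.sum_mul_sum, Finset.sum_mul_sum, ← Finset.sum_add_distrib]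
    refine Finset.sum_congr rfl fun i _ => ?_
    rw [← Finset.sum_add_distrib]
    refine Finset.sum_congr rfl fun j _ => ?_
    rw [Real.cos_sub]
    ring
  rw [this]
  positivity

/-! ### Fourier comparison of the kernels -/

/-- A trigonometric polynomial whose square is dominated by `perKernel`. -/
def trigKernel (s t : ℝ) : ℝ := 99 / 100 + 1 / 8 * Real.cos (2 * Real.pi * (s - t))

/-- `perKernel s t - 1` is `3 B₂(|s - t|)` with the Bernoulli polynomial `B₂`. The term `n = 0`
vanishes because `1 / 0 = 0`. -/
lemma hasSum_perKernel {s t : ℝ} (hs : s ∈ Set.Ico (0 : ℝ) 1) (ht : t ∈ Set.Ico (0 : ℝ) 1) :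
    HasSum (fun n : ℕ => 3 / Real.pi ^ 2 * (1 / (n : ℝ) ^ 2 *
      Real.cos (2 * Real.pi * n * (s - t)))) (perKernel s t - 1) := by
  have hx : |s - t| ∈ Set.Icc (0 : ℝ) 1 :=
    ⟨abs_nonneg _, abs_le.2 ⟨by linarith [hs.1, ht.2], by linarith [hs.2, ht.1]⟩⟩
  have h := (hasSum_one_div_nat_pow_mul_cos one_ne_zero hx).mul_left (3 / Real.pi ^ 2)
  have hcos : ∀ n : ℕ, Real.cos (2 * Real.pi * n * |s - t|) =
      Real.cos (2 * Real.pi * n * (s - t)) := by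
    intro n
    rcases abs_choice (s - t) with h | h <;> rw [h]
    rw [mul_neg, Real.cos_neg]
  simp only [hcos, mul_one] at h
  convert! h using 1
  have hb : (Polynomial.map (algebraMap ℚ ℝ) (Polynomial.bernoulli 2)).eval |s - t| =
      |s - t| ^ 2 - |s - t| + 1 / 6 := by
    simp [Polynomial.bernoulli, Finset.sum_range_succ, bernoulli_one,
      bernoulli_eq_bernoulli'_of_ne_one (by decide : 2 ≠ 1)]
    ring
  rw [hb, perKernel]
  have := Real.pi_ne_zero
  simp [Nat.factorial]
  field_simp
  ring

lemma three_div_pi_sq_gt : 3 / 10 < 3 / Real.pi ^ 2 := by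
  have h := Real.pi_lt_d2
  have h0 := Real.pi_pos
  rw [div_lt_div_iff₀ (by norm_num) (by positivity)]
  nlinarith

lemma posSemidef_trigKernel (p : Fin N → ℝ) :
    (Matrix.of fun j k => trigKernel (p j) (p k)).PosSemidef := by
  refine posSemidef_of_sum_nonneg (fun j k => ?_) fun w => ?_
  · simp only [Matrix.of_apply, trigKernel]
    rw [← Real.cos_neg]
    ring_nf
  · have h1 := sum_cos_sub_nonneg w fun j => 2 * Real.pi * p j
    have h0 := mul_self_nonneg (∑ j, w j)
    rw [Finset.sum_mul_sum] at h0
    have : ∑ j, ∑ k, w j * w k * (Matrix.of fun j k => trigKernel (p j) (p k)) j k =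
        99 / 100 * ∑ j, ∑ k, w j * w k +
          1 / 8 * ∑ j, ∑ k, w j * w k * Real.cos (2 * Real.pi * p j - 2 * Real.pi * p k) := by
      simp only [Finset.mul_sum, ← Finset.sum_add_distrib, Matrix.of_apply, trigKernel,
        ← mul_sub]
      exact Finset.sum_congr rfl fun i _ => Finset.sum_congr rfl fun j _ => by ring
    rw [this]
    positivity

/-- Fourier coefficients are compared. With `a = 99/100` and `b = 1/8`, the square of `a + b cos`
has coefficients `a² + b²/2 < 1`, `2ab = 99/400 < 3/10` and `b²/2 = 1/128 < 3/40` at frequencies 0,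
1, 2. Those of `perKernel` are `1`, `3/π²` and `3/(4π²)`. -/
lemma posSemidef_perKernel_sub_sq {p : Fin N → ℝ} (hp : ∀ j, p j ∈ Set.Ico (0 : ℝ) 1) :
    (Matrix.of fun j k => perKernel (p j) (p k) - trigKernel (p j) (p k) ^ 2).PosSemidef := by
  refine posSemidef_of_sum_nonneg (fun j k => ?_) fun w => ?_
  · simp only [Matrix.of_apply, trigKernel, perKernel]
    rw [← Real.cos_neg, abs_sub_comm]
    ring_nf
  · let F : ℕ → ℝ := fun n => ∑ j, ∑ k, w j * w k * Real.cos (2 * Real.pi * n * (p j - p k))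
    have hF : ∀ n, 0 ≤ F n := fun n => by
      simpa only [F, mul_sub] using sum_cos_sub_nonneg w fun j => 2 * Real.pi * n * p j
    have hsum : HasSum (fun n : ℕ => 3 / Real.pi ^ 2 * (1 / (n : ℝ) ^ 2 * F n))
        (∑ j, ∑ k, w j * w k * (perKernel (p j) (p k) - 1)) := by
      have := hasSum_sum (s := Finset.univ) fun (j : Fin N) _ => hasSum_sum (s := Finset.univ)
        fun (k : Fin N) _ => (hasSum_perKernel (hp j) (hp k)).mul_left (w j * w k)
      convert! this using 1
      funext n
      simp only [F, Finset.mul_sum]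
      exact Finset.sum_congr rfl fun i _ => Finset.sum_congr rfl fun j _ => by ring
    -- All other frequencies contribute nonnegatively and are dropped.
    have hle := sum_le_hasSum {1, 2} (fun n _ => by have := hF n; positivity) hsum
    rw [Finset.sum_pair (by norm_num)] at hle
    have e : ∑ j, ∑ k, w j * w k *
          (Matrix.of fun j k => perKernel (p j) (p k) - trigKernel (p j) (p k) ^ 2) j k =
        (∑ j, ∑ k, w j * w k * (perKernel (p j) (p k) - 1)) +
          (1 - (99 / 100) ^ 2 - 1 / 128) * F 0 - 99 / 400 * F 1 - 1 / 128 * F 2 := by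
      simp only [F, Finset.mul_sum, ← Finset.sum_add_distrib, ← Finset.sum_sub_distrib,
        Matrix.of_apply, trigKernel]
      refine Finset.sum_congr rfl fun i _ => Finset.sum_congr rfl fun j _ => ?_
      have h2 : Real.cos (2 * Real.pi * (2 : ℕ) * (p i - p j)) =
          2 * Real.cos (2 * Real.pi * (p i - p j)) ^ 2 - 1 := by
        rw [← Real.cos_two_mul]
        push_cast
        ring_nf
      rw [h2]
      simp only [Nat.cast_zero, Nat.cast_one, mul_zero, zero_mul, Real.cos_zero, mul_one]
      ring
    rw [e]
    have h0 := hF 0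
    have h1 := mul_le_mul_of_nonneg_right three_div_pi_sq_gt.le (hF 1)
    have h2 := mul_le_mul_of_nonneg_right three_div_pi_sq_gt.le (hF 2)
    have h1' := hF 1
    have h2' := hF 2
    norm_num at hle
    linarith

/-- Vybíral's inequality applies to the product of the `trigKernel` matrices, whose diagonal is
constantly `(223/200)^d`; its Schur square is dominated by the product of the `perKernel` matrices.
-/
lemma sq_sum_le_card_mul_sum_perKernel {P : Fin N → Fin d → ℝ} (hP : InUnitCube P)
    (w : Fin N → ℝ) :
    ((223 / 200 : ℝ) ^ 2) ^ d * (∑ j, w j) ^ 2 ≤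
      N * ∑ j, ∑ k, w j * w k * ∏ i, perKernel (P j i) (P k i) := by
  let A : Fin d → Matrix (Fin N) (Fin N) ℝ := fun i =>
    Matrix.of fun j k => perKernel (P j i) (P k i)
  let T : Fin d → Matrix (Fin N) (Fin N) ℝ := fun i =>
    Matrix.of fun j k => trigKernel (P j i) (P k i)
  have hT : ∀ i, (T i).PosSemidef := fun i => posSemidef_trigKernel fun j => P j i
  have h1 := sq_sum_diag_le_card_mul_sum_sq (posSemidef_prod Finset.univ T hT) w
  have h2 := sum_nonneg_of_posSemidef (posSemidef_prod_sub_prod Finset.univ A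
    (fun i => (T i).hadamard (T i)) (fun i => (hT i).hadamard (hT i)) fun i => by
      convert! posSemidef_perKernel_sub_sq (p := fun j => P j i) (fun j => hP j i) using 1
      ext j k
      simp [A, T, Matrix.hadamard_apply, sq]) w
  have hdiag : ∀ s, trigKernel s s = 223 / 200 := fun s => by
    rw [trigKernel, sub_self, mul_zero, Real.cos_zero]; norm_num
  simp only [Matrix.of_apply, Matrix.hadamard_apply, A, T, hdiag, Finset.prod_const,
    Finset.card_univ, Fintype.card_fin, mul_sub, Finset.sum_sub_distrib,
    ← sq, Finset.prod_pow, ← Finset.sum_mul] at h1 h2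
  calc _ = ((∑ j, w j) * (223 / 200) ^ d) ^ 2 := by rw [mul_pow, ← pow_mul, ← pow_mul]; ring
    _ ≤ _ := h1
    _ ≤ _ := mul_le_mul_of_nonneg_left (sub_nonneg.1 h2) (Nat.cast_nonneg N)

/-! ### Lower bounds on the number of points -/

lemma perKernel_self (s : ℝ) : perKernel s s = 3 / 2 := by simp [perKernel]

lemma perKernel_nonneg (s t : ℝ) : 0 ≤ perKernel s t := by
  unfold perKernel
  nlinarith [sq_nonneg (|s - t| - 1 / 2)]

/-- All off-diagonal terms are nonnegative, so only the diagonal is kept. -/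
lemma sum_sq_mul_le_of_nonneg (P : Fin N → Fin d → ℝ) {w : Fin N → ℝ} (hw : ∀ j, 0 ≤ w j) :
    ∑ j, w j ^ 2 * (3 / 2 : ℝ) ^ d ≤ ∑ j, ∑ k, w j * w k * ∏ i, perKernel (P j i) (P k i) := by
  refine Finset.sum_le_sum fun j _ => ?_
  refine le_trans (le_of_eq ?_) (Finset.single_le_sum (f := fun k =>
    w j * w k * ∏ i, perKernel (P j i) (P k i)) (fun k _ => ?_) (Finset.mem_univ j))
  · simp only [perKernel_self, sq, Finset.prod_const, Finset.card_univ, Fintype.card_fin]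
  · exact mul_nonneg (mul_nonneg (hw j) (hw k))
      (Finset.prod_nonneg fun i _ => perKernel_nonneg _ _)

lemma le_card_of_normalizedError_le_of_equal_weights (hN : 0 < N) (P : Fin N → Fin d → ℝ) {ε : ℝ}
    (h : normalizedError P (fun _ => 1 / (N : ℝ)) ≤ ε ^ 2) :
    1 / (1 + ε ^ 2) * (3 / 2 : ℝ) ^ d ≤ N := by
  have hN' : (0 : ℝ) < N := Nat.cast_pos.2 hN
  have h1 := sum_sq_mul_le_of_nonneg P (w := fun _ => 1 / (N : ℝ)) fun _ => by positivity
  unfold normalizedError at h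
  simp only [Finset.sum_const, Finset.card_univ, Fintype.card_fin, nsmul_eq_mul] at h h1
  have e1 : (N : ℝ) * (1 / N) = 1 := by field_simp
  have e2 : (N : ℝ) * ((1 / N) ^ 2 * (3 / 2 : ℝ) ^ d) = (3 / 2 : ℝ) ^ d / N := by field_simp
  rw [e1] at h
  rw [e2] at h1
  have h2 : (3 / 2 : ℝ) ^ d / N ≤ 1 + ε ^ 2 := by linarith
  rw [div_le_iff₀ hN'] at h2
  rw [one_div_mul_eq_div, div_le_iff₀ (by positivity)]
  linarith

lemma le_card_of_normalizedError_le_of_nonneg_weights (P : Fin N → Fin d → ℝ) {w : Fin N → ℝ}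
    (hw : ∀ j, 0 ≤ w j) {ε : ℝ} (h : normalizedError P w ≤ ε ^ 2) :
    (1 - ε ^ 2) * (3 / 2 : ℝ) ^ d ≤ N := by
  have h1 := sum_sq_mul_le_of_nonneg P hw
  set C : ℝ := (3 / 2 : ℝ) ^ d
  have hC : 0 < C := by positivity
  -- Completing the square at the optimal weight `1 / C`.
  have h2 : ∑ j, (2 * w j - 1 / C) ≤ ∑ j, w j ^ 2 * C := by
    refine Finset.sum_le_sum fun j _ => ?_
    have : w j ^ 2 * C - (2 * w j - 1 / C) = C * (w j - 1 / C) ^ 2 := by field_simp; ring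
    have : 0 ≤ C * (w j - 1 / C) ^ 2 := by positivity
    linarith
  rw [Finset.sum_sub_distrib, ← Finset.mul_sum] at h2
  simp only [Finset.sum_const, Finset.card_univ, Fintype.card_fin, nsmul_eq_mul] at h2
  unfold normalizedError at h
  rw [← le_div_iff₀ hC]
  have : (N : ℝ) * (1 / C) = N / C := by ring
  linarith

lemma le_card_of_normalizedError_le {P : Fin N → Fin d → ℝ} (hP : InUnitCube P) {w : Fin N → ℝ}
    {ε : ℝ} (h : normalizedError P w ≤ ε ^ 2) :
    (1 - ε ^ 2) * ((223 / 200 : ℝ) ^ 2) ^ d ≤ N := by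
  have h1 := sq_sum_le_card_mul_sum_perKernel hP w
  unfold normalizedError at h
  set C : ℝ := ((223 / 200 : ℝ) ^ 2) ^ d
  have hC : 0 < C := by positivity
  set S := ∑ j, w j
  set Q := ∑ j, ∑ k, w j * w k * ∏ i, perKernel (P j i) (P k i)
  have hN : (0 : ℝ) ≤ N := Nat.cast_nonneg N
  have h2 : N * (1 - ε ^ 2) * C ≤ (N : ℝ) * N := by
    have h3 : (N : ℝ) * (1 - ε ^ 2) ≤ N * (2 * S - Q) :=
      mul_le_mul_of_nonneg_left (by linarith) hN
    have h4 : (N : ℝ) * (1 - ε ^ 2) * C ≤ (2 * N * S - C * S ^ 2) * C :=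
      mul_le_mul_of_nonneg_right (by linarith) hC.le
    -- The square vanishes at `S = N / C`, the minimizer of `C S² / N - 2 S + 1`, where the value is
    -- `1 - N / C`.
    nlinarith [sq_nonneg (C * S - N)]
  -- For `N = 0` the error is `1`, so `1 ≤ ε²` and the left side is nonpositive.
  rcases hN.eq_or_lt with h0 | h0
  · have : N = 0 := by exact_mod_cast h0.symm
    subst this
    have : S = 0 := by simp [S]
    have : Q = 0 := by simp [Q]
    nlinarith
  · nlinarith

/-! ### Regular grids reach every error level -/

lemma sum_range_abs_sub (m : ℕ) :
    ∑ a ∈ Finset.range m, ∑ b ∈ Finset.range m, |(a : ℝ) - b| = ((m : ℝ) ^ 3 - m) / 3 := by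
  have hs : ∀ n : ℕ, ∑ a ∈ Finset.range n, ((n : ℝ) - a) = n * (n + 1) / 2 := by
    intro n
    rw [Finset.sum_sub_distrib, Finset.sum_const, Finset.card_range, nsmul_eq_mul]
    have h2 : (∑ a ∈ Finset.range n, (a : ℝ)) * 2 = n * (n - 1) := by
      induction n with
      | zero => simp
      | succ n ih =>
        rw [Finset.sum_range_succ, add_mul, ih]
        push_cast
        ring
    linarith
  induction m with
  | zero => simp
  | succ n ih =>
    have h1 : ∑ a ∈ Finset.range n, |(a : ℝ) - n| = n * (n + 1) / 2 := by
      rw [← hs]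
      refine Finset.sum_congr rfl fun a ha => ?_
      have : (a : ℝ) < n := by exact_mod_cast Finset.mem_range.1 ha
      rw [abs_of_neg (by linarith)]
      ring
    simp only [Finset.sum_range_succ, Finset.sum_add_distrib, ih, abs_sub_comm (n : ℝ), h1]
    push_cast
    simp
    ring

lemma sum_range_sub_sq (m : ℕ) :
    ∑ a ∈ Finset.range m, ∑ b ∈ Finset.range m, ((a : ℝ) - b) ^ 2 =
      (m : ℝ) ^ 2 * (m ^ 2 - 1) / 6 := by
  have h1 : ∀ n : ℕ, ∑ a ∈ Finset.range n, ((a : ℝ) - n) ^ 2 = n * (n + 1) * (2 * n + 1) / 6 := by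
    intro n
    rw [← Finset.sum_range_reflect]
    have : ∀ k ∈ Finset.range n, (((n - 1 - k : ℕ) : ℝ) - n) ^ 2 = ((k : ℝ) + 1) ^ 2 := by
      intro k hk
      have hk := Finset.mem_range.1 hk
      rw [Nat.sub_sub, Nat.cast_sub (by omega)]
      push_cast
      ring
    rw [Finset.sum_congr rfl this]
    clear this
    induction n with
    | zero => simp
    | succ n ih =>
      rw [Finset.sum_range_succ, ih]
      push_cast
      ring
  induction m with
  | zero => simp
  | succ n ih =>
    have h2 : ∑ a ∈ Finset.range n, ((n : ℝ) - a) ^ 2 = n * (n + 1) * (2 * n + 1) / 6 := by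
      rw [← h1]
      exact Finset.sum_congr rfl fun a _ => by ring
    simp only [Finset.sum_range_succ, Finset.sum_add_distrib, ih, h1, h2]
    push_cast
    ring

/-- The excess over `m²` stays bounded, so the normalized error of the grid tends to zero as `m`
grows. -/
lemma sum_perKernel_grid {m : ℕ} (hm : 0 < m) :
    ∑ a : Fin m, ∑ b : Fin m, perKernel ((a : ℝ) / m) ((b : ℝ) / m) = (m : ℝ) ^ 2 + 1 / 2 := by
  have hm' : (0 : ℝ) < m := Nat.cast_pos.2 hm
  have hk : ∀ a b : ℕ, perKernel ((a : ℝ) / m) ((b : ℝ) / m) =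
      3 / 2 - 3 / m * |(a : ℝ) - b| + 3 / m ^ 2 * ((a : ℝ) - b) ^ 2 := by
    intro a b
    rw [perKernel, ← sub_div, abs_div, abs_of_pos hm', div_pow, sq_abs]
    ring
  simp only [hk]
  rw [Fin.sum_univ_eq_sum_range (fun a : ℕ => ∑ b : Fin m,
    (3 / 2 - 3 / (m : ℝ) * |(a : ℝ) - (b : ℕ)| + 3 / (m : ℝ) ^ 2 * ((a : ℝ) - (b : ℕ)) ^ 2)) m]
  have : ∀ a : ℕ, ∑ b : Fin m,
      (3 / 2 - 3 / (m : ℝ) * |(a : ℝ) - (b : ℕ)| + 3 / (m : ℝ) ^ 2 * ((a : ℝ) - (b : ℕ)) ^ 2) =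
      ∑ b ∈ Finset.range m,
        (3 / 2 - 3 / (m : ℝ) * |(a : ℝ) - b| + 3 / (m : ℝ) ^ 2 * ((a : ℝ) - b) ^ 2) :=
    fun a => Fin.sum_univ_eq_sum_range (fun b : ℕ =>
      3 / 2 - 3 / (m : ℝ) * |(a : ℝ) - b| + 3 / (m : ℝ) ^ 2 * ((a : ℝ) - b) ^ 2) m
  simp only [this, Finset.sum_add_distrib, Finset.sum_sub_distrib, ← Finset.mul_sum,
    sum_range_abs_sub, sum_range_sub_sq, Finset.sum_const, Finset.card_range, nsmul_eq_mul]
  field_simp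
  ring

/-- The regular grid with `m ^ d` points. -/
def gridPoints (d m : ℕ) (j : Fin (m ^ d)) (i : Fin d) : ℝ :=
  ((finFunctionFinEquiv.symm j i : Fin m) : ℝ) / m

lemma inUnitCube_gridPoints (d m : ℕ) : InUnitCube (gridPoints d m) := by
  intro j i
  have h : ((finFunctionFinEquiv.symm j i : Fin m) : ℕ) < m := Fin.is_lt _
  have hm : (0 : ℝ) < m := Nat.cast_pos.2 (by omega)
  refine ⟨by unfold gridPoints; positivity, ?_⟩
  rw [gridPoints, div_lt_one hm]
  exact_mod_cast h

lemma sum_prod_perKernel_gridPoints (d : ℕ) {m : ℕ} (hm : 0 < m) :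
    ∑ j, ∑ k, ∏ i, perKernel (gridPoints d m j i) (gridPoints d m k i) =
      ((m : ℝ) ^ 2 + 1 / 2) ^ d := by
  have h : ∀ f : Fin d → Fin m,
      ∑ k, ∏ i, perKernel ((f i : ℝ) / m) (gridPoints d m k i) =
        ∏ i, ∑ b : Fin m, perKernel ((f i : ℝ) / m) ((b : ℝ) / m) := by
    intro f
    rw [Fintype.prod_sum]
    exact finFunctionFinEquiv.symm.sum_comp fun g : Fin d → Fin m =>
      ∏ i, perKernel ((f i : ℝ) / m) ((g i : ℝ) / m)
  calc _ = ∑ f : Fin d → Fin m, ∑ k, ∏ i, perKernel ((f i : ℝ) / m) (gridPoints d m k i) :=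
        finFunctionFinEquiv.symm.sum_comp fun f : Fin d → Fin m =>
          ∑ k, ∏ i, perKernel ((f i : ℝ) / m) (gridPoints d m k i)
    _ = ∏ _i : Fin d, ∑ a : Fin m, ∑ b : Fin m, perKernel ((a : ℝ) / m) ((b : ℝ) / m) := by
        simp only [h]
        rw [Fintype.prod_sum]
    _ = _ := by simp [sum_perKernel_grid hm]

lemma normalizedError_gridPoints (d : ℕ) {m : ℕ} (hm : 0 < m) :
    normalizedError (gridPoints d m) (fun _ => 1 / ((m ^ d : ℕ) : ℝ)) =
      (1 + 1 / (2 * (m : ℝ) ^ 2)) ^ d - 1 := by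
  have hm' : (0 : ℝ) < m := Nat.cast_pos.2 hm
  unfold normalizedError
  simp only [← Finset.mul_sum, sum_prod_perKernel_gridPoints d hm, Finset.sum_const,
    Finset.card_univ, Fintype.card_fin, nsmul_eq_mul]
  have e1 : ((m ^ d : ℕ) : ℝ) * (1 / ((m ^ d : ℕ) : ℝ)) = 1 := by
    push_cast
    field_simp
  have e2 : 1 + 1 / (2 * (m : ℝ) ^ 2) = ((m : ℝ) ^ 2 + 1 / 2) / (m : ℝ) ^ 2 := by
    field_simp
  rw [e1, e2, div_pow, ← pow_mul, mul_comm 2 d, pow_mul]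
  push_cast
  field_simp
  ring

/-- Needed because `sInf ∅ = 0` would break the lower bounds; equal weights serve all three
inverses. -/
lemma exists_perL2Discrepancy_le (d : ℕ) {ε : ℝ} (hε : 0 < ε) :
    ∃ N : ℕ, 0 < N ∧ ∃ P : Fin N → Fin d → ℝ, InUnitCube P ∧
      perL2Discrepancy P ≤ ε * initialPerL2Discrepancy d := by
  have h : Filter.Tendsto (fun m : ℕ => (1 + 1 / (2 * (m : ℝ) ^ 2)) ^ d - 1) Filter.atTop
      (nhds ((1 + 0) ^ d - 1)) := by
    refine (((tendsto_const_nhds.add ?_).pow d).sub_const 1)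
    refine tendsto_const_nhds.div_atTop (Filter.Tendsto.const_mul_atTop (by norm_num) ?_)
    exact (Filter.tendsto_pow_atTop (by norm_num)).comp tendsto_natCast_atTop_atTop
  have h0 : ((1 + 0 : ℝ)) ^ d - 1 < ε ^ 2 := by
    rw [add_zero, one_pow, sub_self]
    positivity
  obtain ⟨m, hm, hm0⟩ := ((h.eventually_lt_const h0).and (Filter.eventually_gt_atTop 0)).exists
  refine ⟨m ^ d, by positivity, gridPoints d m, inUnitCube_gridPoints d m, ?_⟩
  rw [perL2Discrepancy, weightedPerL2Discrepancy_le_iff (inUnitCube_gridPoints d m) _ hε,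
    normalizedError_gridPoints d hm0]
  exact hm.le

/-! ### Bounds for the inverses and the theorem -/

lemma le_inversePer {ε : ℝ} (hε : 0 < ε) (d : ℕ) :
    1 / (1 + ε ^ 2) * (3 / 2 : ℝ) ^ d ≤ inversePer ε d := by
  obtain ⟨hN, P, hP, h⟩ := Nat.sInf_mem (exists_perL2Discrepancy_le d hε)
  exact le_card_of_normalizedError_le_of_equal_weights hN P
    ((weightedPerL2Discrepancy_le_iff hP _ hε).1 h)

lemma le_inversePerNonnegWeights {ε : ℝ} (hε : 0 < ε) (d : ℕ) :
    (1 - ε ^ 2) * (3 / 2 : ℝ) ^ d ≤ inversePerNonnegWeights ε d := by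
  have hne : {N : ℕ | 0 < N ∧ ∃ (P : Fin N → Fin d → ℝ) (w : Fin N → ℝ), InUnitCube P ∧
      (∀ j, 0 ≤ w j) ∧
      weightedPerL2Discrepancy P w ≤ ε * initialPerL2Discrepancy d}.Nonempty := by
    obtain ⟨N, hN, P, hP, h⟩ := exists_perL2Discrepancy_le d hε
    exact ⟨N, hN, P, _, hP, fun _ => by positivity, h⟩
  obtain ⟨-, P, w, hP, hw, h⟩ := Nat.sInf_mem hne
  exact le_card_of_normalizedError_le_of_nonneg_weights P hw
    ((weightedPerL2Discrepancy_le_iff hP _ hε).1 h)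

lemma le_inversePerWeights {ε : ℝ} (hε : 0 < ε) (d : ℕ) :
    (1 - ε ^ 2) * ((223 / 200 : ℝ) ^ 2) ^ d ≤ inversePerWeights ε d := by
  have hne : {N : ℕ | 0 < N ∧ ∃ (P : Fin N → Fin d → ℝ) (w : Fin N → ℝ), InUnitCube P ∧
      weightedPerL2Discrepancy P w ≤ ε * initialPerL2Discrepancy d}.Nonempty := by
    obtain ⟨N, hN, P, hP, h⟩ := exists_perL2Discrepancy_le d hε
    exact ⟨N, hN, P, _, hP, h⟩
  obtain ⟨-, P, w, hP, h⟩ := Nat.sInf_mem hne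
  exact le_card_of_normalizedError_le hP ((weightedPerL2Discrepancy_le_iff hP _ hε).1 h)

end

end PeriodicDiscrepancy

theorem theorem2 :
    (∀ (ε : ℝ) (d : ℕ), 0 < ε → ε < 1 → 1 ≤ d →
      1 / (1 + ε ^ 2) * (3 / 2 : ℝ) ^ d ≤ (PeriodicDiscrepancy.inversePer ε d : ℝ) ∧
      (1 - ε ^ 2) * (3 / 2 : ℝ) ^ d ≤
        (PeriodicDiscrepancy.inversePerNonnegWeights ε d : ℝ)) ∧
    (∀ ε₀ : ℝ, 0 < ε₀ → ε₀ < 1 → ∃ c : ℝ, 0 < c ∧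
      ∀ (d : ℕ) (ε : ℝ), 1 ≤ d → 0 < ε → ε < ε₀ →
        c * (1.0628 : ℝ) ^ d ≤ (PeriodicDiscrepancy.inversePerWeights ε d : ℝ)) := by
  refine ⟨fun ε d hε _ _ => ⟨PeriodicDiscrepancy.le_inversePer hε d,
    PeriodicDiscrepancy.le_inversePerNonnegWeights hε d⟩, fun ε₀ h0 h1 => ?_⟩
  have hc : 0 < 1 - ε₀ ^ 2 := by nlinarith
  refine ⟨1 - ε₀ ^ 2, hc, fun d ε _ hε hεε₀ => ?_⟩
  refine le_trans ?_ (PeriodicDiscrepancy.le_inversePerWeights hε d)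
  -- There is ample room: `(223/200)² = 1.243225`.
  have h2 : (1.0628 : ℝ) ^ d ≤ ((223 / 200 : ℝ) ^ 2) ^ d :=
    pow_le_pow_left₀ (by norm_num) (by norm_num) d
  have h3 : 1 - ε₀ ^ 2 ≤ 1 - ε ^ 2 := by nlinarith
  exact mul_le_mul h3 h2 (by positivity) (hc.le.trans h3)
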